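/- Let $\Bbbk$ be an algebraically closed field of characteristic zero, and let $h\in\Bbbk[x]$ be a monic polynomial of degree $N\ge 1$ whose coefficient of $x^{N-1}$ is zero. Let $A_h$ be the $\Bbbk$-algebra generated by $x$ and $t$ subject to the relation $tx=xt+h(x)$. Let $\mathrm{Aut}(A_h)$ be its group of $\Bbbk$-automorphisms, and let $\mathrm{Der}(A_h)$ be the $\Bbbk$-space of its $\Bbbk$-derivations, on which $\mathrm{Aut}(A_h)$ acts by $\rho\cdot D=\rho D\rho^{-1}$. The isotropy group of $D\in\mathrm{Der}(A_h)$ is $\mathrm{Aut}_D(A_h)=\{\rho\in\mathrm{Aut}(A_h) : \rho D=D\rho\}$. For $s\in\Bbbk[x]$ let $\Delta_s\in\mathrm{Der}(A_h)$ be the derivation with $\Delta_s(x)=0$ and $\Delta_s(t)=s(x)$. Put $\Delta(A_h)=\{\Delta_s : s\in\Bbbk[x],\ \deg s<\deg h\}$ (with $\deg 0=-\infty$) and $\mathrm{Inn}(A_h)=\{ad_w : w\in A_h\}$, where $ad_w(u)=wu-uw$. For $r\in\Bbbk[x]$ let $\sigma_r\in\mathrm{Aut}(A_h)$ be given by $\sigma_r(x)=x$,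 $\sigma_r(t)=t+r(x)$; for $a\in\Bbbk^*$ with $h(ax)=a^Nh(x)$ let $\tau_a\in\mathrm{Aut}(A_h)$ be given by $\tau_a(x)=ax$, $\tau_a(t)=a^{N-1}t$. Then: 1. Every $\rho\in\mathrm{Aut}(A_h)$ has the form $\rho=\sigma_r\circ\tau_a$ for some $r\in\Bbbk[x]$ and some $a\in\Bbbk^*$ with $h(ax)=a^Nh(x)$; and for every such $\rho=\sigma_r\circ\tau_a$ and every $s\in\Bbbk[x]$ with $\deg s<\deg h$, one has $\rho\,\Delta_s\,\rho^{-1}=\Delta_{a^{1-N}s(ax)}$. 2. $\mathrm{Inn}(A_h)$ and $\Delta(A_h)$ are $\mathrm{Aut}(A_h)$-submodules of $\mathrm{Der}(A_h)$ (that is, $\Bbbk$-subspaces stable under the action), and they are independent: $\mathrm{Inn}(A_h)\cap\Delta(A_h)=0$. 3. For every $w\in A_h$ and every $s\in\Bbbk[x]$ with $\deg s<\deg h$, one has $\mathrm{Aut}_{ad_w+\Delta_s}(A_h)=\mathrm{Aut}_{ad_w}(A_h)\cap\mathrm{Aut}_{\Delta_s}(A_h)$. -/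

import Mathlib

open Polynomial

noncomputable section

namespace DiffOre

section General

variable (k : Type*) [Field k] (R : Type*) [Ring R] [Algebra k R]

/-- The `k`-space `Der(R)` of `k`-derivations of a (noncommutative) `k`-algebra `R`:
the `k`-linear maps `D : R → R` that satisfy the Leibniz rule. -/
def Der : Submodule k (Module.End k R) where
  carrier := {D | ∀ u v : R, D (u * v) = D u * v + u * D v}
  add_mem' {D E} hD hE := by
    intro u v
    simp only [LinearMap.add_apply, hD u v, hE u v, add_mul, mul_add]
    abel
  zero_mem' := by intro u v; simp
  smul_mem' c D hD := by
    intro u v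
    simp only [LinearMap.smul_apply, hD u v, smul_add, smul_mul_assoc, mul_smul_comm]

/-- The conjugation action of `Aut(R)` on `Der(R)`, `ρ · D = ρ D ρ⁻¹`, as a `k`-linear
representation. -/
def conjRep : Representation k (R ≃ₐ[k] R) (Der k R) where
  toFun ρ :=
    { toFun := fun D => ⟨ρ.toLinearMap ∘ₗ (D : Module.End k R) ∘ₗ ρ.symm.toLinearMap, by
        intro u v
        simp [D.2 (ρ.symm u) (ρ.symm v)]⟩
      map_add' := fun D E => by ext u; simp
      map_smul' := fun c D => by ext u; simp }
  map_one' := by ext D u; rfl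
  map_mul' ρ τ := by ext D u; rfl

variable {R}

/-- The inner derivation `ad_w = [w, -]`. -/
def ad (w : R) : Der k R :=
  ⟨LinearMap.mulLeft k w - LinearMap.mulRight k w, by
    intro u v
    simp only [LinearMap.sub_apply, LinearMap.mulLeft_apply, LinearMap.mulRight_apply,
      sub_mul, mul_sub, mul_assoc]
    abel⟩

theorem ad_apply (w u : R) : (ad k w : Module.End k R) u = w * u - u * w := rfl

variable (R) in
/-- The set `Inn(R) = {ad_w | w ∈ R}` of inner derivations. -/
def Inn : Set (Der k R) := {D | ∃ w : R, D = ad k w}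

variable {k}

/-- The isotropy group `Aut_D(R) = {ρ ∈ Aut(R) | ρ D = D ρ}` of a derivation `D`. -/
def isotropy (D : Der k R) : Subgroup (R ≃ₐ[k] R) where
  carrier := {ρ | ∀ u : R, ρ ((D : Module.End k R) u) = (D : Module.End k R) (ρ u)}
  mul_mem' {ρ τ} hρ hτ := by
    intro u
    rw [AlgEquiv.mul_apply, AlgEquiv.mul_apply, hτ u, hρ (τ u)]
  one_mem' := by intro u; rfl
  inv_mem' {ρ} hρ := by
    intro u
    change ρ.symm ((D : Module.End k R) u) = (D : Module.End k R) (ρ.symm u)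
    rw [AlgEquiv.symm_apply_eq, hρ, AlgEquiv.apply_symm_apply]

end General

variable {k : Type*} [Field k]

/-- The two generators of `A_h`. -/
inductive Gen : Type
  | x
  | t

/-- The defining relation `t x = x t + h(x)` in the free algebra `k⟨x, t⟩`. -/
inductive Rel (h : k[X]) : FreeAlgebra k Gen → FreeAlgebra k Gen → Prop
  | comm : Rel h (FreeAlgebra.ι k Gen.t * FreeAlgebra.ι k Gen.x)
      (FreeAlgebra.ι k Gen.x * FreeAlgebra.ι k Gen.t + aeval (FreeAlgebra.ι k Gen.x) h)

/-- The differential Ore extension `A_h = k[x][t; h ∂ₓ]`: the `k`-algebra generated by `x` and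
`t` subject to the relation `t x = x t + h(x)`. -/
abbrev A (h : k[X]) : Type _ := RingQuot (Rel h)

/-- The generator `x` of `A_h`. -/
def x (h : k[X]) : A h := RingQuot.mkAlgHom k (Rel h) (FreeAlgebra.ι k Gen.x)

/-- The generator `t` of `A_h`. -/
def t (h : k[X]) : A h := RingQuot.mkAlgHom k (Rel h) (FreeAlgebra.ι k Gen.t)

/-- The canonical map `k[x] → A_h`, `p ↦ p(x)`. -/
def poly (h : k[X]) : k[X] →ₐ[k] A h := aeval (x h)

theorem t_mul_x (h : k[X]) : t h * x h = x h * t h + poly h h := by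
  have := RingQuot.mkAlgHom_rel k (Rel.comm (h := h))
  rw [map_mul, map_add, map_mul, ← aeval_algHom_apply] at this
  exact this

section Lift

variable {B : Type*} [Ring B] [Algebra k B]

/-- The universal property of `A_h`. -/
def lift (h : k[X]) (X T : B) (hXT : T * X = X * T + aeval X h) : A h →ₐ[k] B :=
  RingQuot.liftAlgHom k ⟨FreeAlgebra.lift k (fun g => Gen.casesOn g X T), by
    rintro _ _ ⟨⟩
    simp only [map_mul, map_add, FreeAlgebra.lift_ι_apply, ← aeval_algHom_apply]
    exact hXT⟩

@[simp] theorem lift_x (h : k[X]) (X T : B) (hXT : T * X = X * T + aeval X h) :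
    lift h X T hXT (x h) = X := by
  simp [lift, x]

@[simp] theorem lift_t (h : k[X]) (X T : B) (hXT : T * X = X * T + aeval X h) :
    lift h X T hXT (t h) = T := by
  simp [lift, t]

@[simp] theorem lift_poly (h : k[X]) (X T : B) (hXT : T * X = X * T + aeval X h) (p : k[X]) :
    lift h X T hXT (poly h p) = aeval X p := by
  rw [poly, ← aeval_algHom_apply, lift_x]

theorem hom_ext {h : k[X]} {f g : A h →ₐ[k] B} (hx : f (x h) = g (x h))
    (ht : f (t h) = g (t h)) : f = g := by
  apply RingQuot.ringQuot_ext' k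
  apply FreeAlgebra.hom_ext
  funext i
  cases i
  · exact hx
  · exact ht

end Lift

theorem x_mul_poly (h p : k[X]) : x h * poly h p = poly h p * x h := by
  have hx : x h = poly h X := by simp [poly]
  rw [hx, ← map_mul, ← map_mul, mul_comm]

/-- The homomorphism `A_h → A_h[ε]`, `ε² = 0`, with `x ↦ x` and `t ↦ t + s(x) ε`. -/
def deltaHom (h s : k[X]) : A h →ₐ[k] TrivSqZeroExt (A h) (A h) :=
  lift h (TrivSqZeroExt.inl (x h)) (TrivSqZeroExt.inl (t h) + TrivSqZeroExt.inr (poly h s)) (by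
    have key : aeval (TrivSqZeroExt.inl (x h) : TrivSqZeroExt (A h) (A h)) h
        = TrivSqZeroExt.inl (poly h h) :=
      aeval_algHom_apply (TrivSqZeroExt.inlAlgHom k (A h) (A h)) (x h) h
    rw [key]
    ext
    · simp [t_mul_x]
    · simp [x_mul_poly])

theorem fst_deltaHom (h s : k[X]) (u : A h) : (deltaHom h s u).fst = u := by
  have : (TrivSqZeroExt.fstHom k (A h) (A h)).comp (deltaHom h s) = AlgHom.id k (A h) := by
    apply hom_ext
    · simp [deltaHom]
    · simp [deltaHom]
  exact DFunLike.congr_fun this u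

/-- The derivation `Δ_s` of `A_h` with `Δ_s(x) = 0` and `Δ_s(t) = s(x)`
(the `ε`-part of the homomorphism `deltaHom`). -/
def Δ (h s : k[X]) : Der k (A h) :=
  ⟨TrivSqZeroExt.sndHom (A h) (A h) |>.restrictScalars k |>.comp (deltaHom h s).toLinearMap, by
    intro u v
    simp [fst_deltaHom, add_comm]⟩

theorem Δ_x (h s : k[X]) : (Δ h s : Module.End k (A h)) (x h) = 0 := by
  simp [Δ, deltaHom]

theorem Δ_t (h s : k[X]) : (Δ h s : Module.End k (A h)) (t h) = poly h s := by
  simp [Δ, deltaHom]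

/-- A derivation of `A_h` is determined by its values at `x` and `t`. -/
theorem der_ext {h : k[X]} {D E : Der k (A h)}
    (hx : (D : Module.End k (A h)) (x h) = (E : Module.End k (A h)) (x h))
    (ht : (D : Module.End k (A h)) (t h) = (E : Module.End k (A h)) (t h)) : D = E := by
  let φ : Der k (A h) → (A h →ₐ[k] TrivSqZeroExt (A h) (A h)) := fun D =>
    AlgHom.ofLinearMap
      ((TrivSqZeroExt.inlAlgHom k (A h) (A h)).toLinearMap
        + (TrivSqZeroExt.inrHom (A h) (A h)).restrictScalars k ∘ₗ (D : Module.End k (A h)))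
      (by
        have h1 : (D : Module.End k (A h)) 1 = 0 := by
          have := D.2 1 1
          simpa using this
        ext <;> simp [h1])
      (by
        intro u v
        ext
        · simp
        · simp [D.2 u v, add_comm])
  have hφ : φ D = φ E := by
    apply hom_ext
    · simp [φ, hx]
    · simp [φ, ht]
  ext u
  have := congrArg TrivSqZeroExt.snd (DFunLike.congr_fun hφ u)
  simpa [φ] using this

/-- The set `Δ(A_h) = {Δ_s | s ∈ k[x], deg s < deg h}`. -/
def DeltaSet (h : k[X]) : Set (Der k (A h)) := {D | ∃ s : k[X], s.degree < h.degree ∧ D = Δ h s}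

/-- The homomorphism `A_h → A_h` with `x ↦ x` and `t ↦ t + r(x)`. -/
def sigmaHom (h r : k[X]) : A h →ₐ[k] A h :=
  lift h (x h) (t h + poly h r) (by
    change _ = _ + poly h h
    rw [add_mul, mul_add, t_mul_x, x_mul_poly]
    abel)

/-- The automorphism `σ_r` of `A_h` with `σ_r(x) = x` and `σ_r(t) = t + r(x)`. -/
def σ (h r : k[X]) : A h ≃ₐ[k] A h :=
  AlgEquiv.ofAlgHom (sigmaHom h r) (sigmaHom h (-r))
    (by
      apply hom_ext
      · simp [sigmaHom]
      · simp [sigmaHom]; simp [poly])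
    (by
      apply hom_ext
      · simp [sigmaHom]
      · simp [sigmaHom]; simp [poly])

theorem σ_x (h r : k[X]) : σ h r (x h) = x h := lift_x ..

theorem σ_t (h r : k[X]) : σ h r (t h) = t h + poly h r := lift_t ..

/-- The condition `h(ax) = a ^ N h(x)`, where `N = deg h`. -/
def IsScaling (h : k[X]) (a : kˣ) : Prop :=
  h.comp (C (a : k) * X) = C ((a : k) ^ h.natDegree) * h

theorem IsScaling.inv {h : k[X]} {a : kˣ} (ha : IsScaling h a) : IsScaling h a⁻¹ := by
  have h1 := congrArg (fun p : k[X] => C ((a : k)⁻¹ ^ h.natDegree) * p.comp (C (a : k)⁻¹ * X)) ha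
  have e : (C (a : k) * X : k[X]).comp (C (a : k)⁻¹ * X) = X := by
    simp [← mul_assoc, ← C_mul]
  simp only [comp_assoc, e, comp_X, mul_comp, C_comp, ← mul_assoc, ← C_mul, ← mul_pow] at h1
  simp at h1
  simpa [IsScaling] using h1.symm

/-- The homomorphism `A_h → A_h` with `x ↦ a x` and `t ↦ a ^ (N - 1) t`. -/
def tauHom (h : k[X]) (a : kˣ) (ha : IsScaling h a) : A h →ₐ[k] A h :=
  lift h ((a : k) • x h) ((a : k) ^ ((h.natDegree : ℤ) - 1) • t h) (by
    have e1 : aeval ((a : k) • x h) h = (a : k) ^ h.natDegree • poly h h := by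
      have := congrArg (poly h) ha
      simpa [poly, aeval_comp, Algebra.smul_def] using this
    have e2 : (a : k) ^ ((h.natDegree : ℤ) - 1) * (a : k) = (a : k) ^ h.natDegree := by
      rw [zpow_sub_one₀ a.ne_zero]
      simp
    rw [e1, smul_mul_smul_comm, smul_mul_smul_comm, mul_comm (a : k), e2, t_mul_x, smul_add])

/-- The automorphism `τ_a` of `A_h` with `τ_a(x) = a x` and `τ_a(t) = a ^ (N - 1) t`,
where `N = deg h` and `h(ax) = a ^ N h(x)`. -/
def τ (h : k[X]) (a : kˣ) (ha : IsScaling h a) : A h ≃ₐ[k] A h :=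
  AlgEquiv.ofAlgHom (tauHom h a ha) (tauHom h a⁻¹ ha.inv)
    (by
      apply hom_ext
      · simp [tauHom, smul_smul]
      · simp [tauHom, smul_smul, ← zpow_add₀ a.ne_zero])
    (by
      apply hom_ext
      · simp [tauHom, smul_smul]
      · simp [tauHom, smul_smul, ← zpow_add₀ a.ne_zero])

theorem τ_x (h : k[X]) (a : kˣ) (ha : IsScaling h a) : τ h a ha (x h) = (a : k) • x h :=
  lift_x ..

theorem τ_t (h : k[X]) (a : kˣ) (ha : IsScaling h a) :
    τ h a ha (t h) = (a : k) ^ ((h.natDegree : ℤ) - 1) • t h :=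
  lift_t ..

end DiffOre

end

/-!
The algebra `A_h` acts on `k[X][Y]`, with `x` acting as multiplication by `X` and `t` as
`Y + h d/dX`. Evaluating this action at `1` shows that the normal form `∑ pᵢ(x) tⁱ` of an element is
unique (`ofSymbol_symbol`, `symbol_poly`), and since `t` raises the `Y`-degree by one and preserves
leading coefficients, the degree in `t` is additive on products (`natDegree_symbol_mul`). In
particular `A_h` is a domain. Comparing the second coefficients of `u x` and `x u` gives, in
characteristic zero, that the centralizer of `x` is `k[x]` (`eq_poly_of_commute_x`).

Automorphisms: `h = [t, x]` generates the commutator ideal `h A_h`, the kernel of the map onto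
`(k[x]/h)[t]`. An automorphism `ρ` preserves this ideal, so `ρ(h) = c h` for a scalar `c`
(`exists_map_poly_eq_smul`). For a root `α` of `h` the element `ρ(x) - α` divides `ρ(h)`, so
`ρ(x) = q(x)` has degree zero in `t` (`exists_map_x_eq_poly`). Now `h(q) = c h` forces
`q = a x + b`, and the vanishing of the coefficient of `x ^ (N - 1)` forces `b = 0`
(`exists_scaling`). Finally `ρ(t) - a ^ (N - 1) t` commutes with `x`, so it lies in `k[x]`
(`exists_eq_σ_mul_τ`).

Derivations: the conjugation formula is a computation on generators (`conjRep_σ_mul_τ_Δ`). If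
`ad_w = Δ_s`, then `w = p(x)` and `s = -h p'`, which is zero when `deg s < deg h`
(`eq_zero_of_ad_eq_Δ`); so `Inn(A_h)` and `Δ(A_h)` are independent. The components of a derivation
in two independent stable subspaces are fixed by whatever fixes their sum (`isotropy_add`).
-/

namespace DiffOre

variable {k : Type*} [Field k]

/-! ### The action on `k[X][Y]` -/

/-- The coefficientwise extension to `k[X][Y]` of the derivation `h d/dX` of `k[X]`. -/
noncomputable def coeffDer (h : k[X]) : k[X][X] →ₗ[k] k[X][X] :=
  lsum fun i => (monomial i).restrictScalars k ∘ₗ LinearMap.mulLeft k h ∘ₗ derivative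

theorem coeffDer_monomial (h p : k[X]) (i : ℕ) :
    coeffDer h (monomial i p) = monomial i (h * derivative p) := by
  simp [coeffDer, sum_monomial_index]

theorem coeff_coeffDer (h : k[X]) (f : k[X][X]) (n : ℕ) :
    (coeffDer h f).coeff n = h * derivative (f.coeff n) := by
  induction f using Polynomial.induction_on' with
  | add f g hf hg => simp [hf, hg, mul_add]
  | monomial i p =>
    rw [coeffDer_monomial, coeff_monomial, coeff_monomial]
    split_ifs <;> simp

/-- The operator `Y + h d/dX` on `k[X][Y]` by which `t` acts. -/
noncomputable def tOp (h : k[X]) : Module.End k k[X][X] := LinearMap.mulLeft k X + coeffDer h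

theorem tOp_monomial (h p : k[X]) (i : ℕ) :
    tOp h (monomial i p) = monomial (i + 1) p + monomial i (h * derivative p) := by
  simp [tOp, coeffDer_monomial]

theorem coeff_zero_tOp (h : k[X]) (f : k[X][X]) :
    (tOp h f).coeff 0 = h * derivative (f.coeff 0) := by
  simp [tOp, coeff_coeffDer]

theorem coeff_succ_tOp (h : k[X]) (f : k[X][X]) (n : ℕ) :
    (tOp h f).coeff (n + 1) = f.coeff n + h * derivative (f.coeff (n + 1)) := by
  simp [tOp, coeff_coeffDer]

theorem natDegree_tOp_pow_le (h : k[X]) {f : k[X][X]} {m : ℕ} (hf : f.natDegree ≤ m) (i : ℕ) :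
    ((tOp h ^ i) f).natDegree ≤ i + m := by
  induction i with
  | zero => simpa using hf
  | succ i ih =>
    rw [natDegree_le_iff_coeff_eq_zero] at ih ⊢
    intro n hn
    obtain ⟨n, rfl⟩ : ∃ j, n = j + 1 := ⟨n - 1, by omega⟩
    rw [pow_succ', Module.End.mul_apply, coeff_succ_tOp, ih n (by omega), ih (n + 1) (by omega)]
    simp

/-- The operator `Y + h d/dX` raises the degree by one and keeps the leading coefficient. -/
theorem coeff_tOp_pow (h : k[X]) {f : k[X][X]} {m : ℕ} (hf : f.natDegree ≤ m) (i : ℕ) :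
    ((tOp h ^ i) f).coeff (i + m) = f.coeff m := by
  induction i with
  | zero => simp
  | succ i ih =>
    have h0 : ((tOp h ^ i) f).coeff (i + m + 1) = 0 :=
      coeff_eq_zero_of_natDegree_lt (Nat.lt_succ_of_le (natDegree_tOp_pow_le h hf i))
    rw [pow_succ', Module.End.mul_apply, show i + 1 + m = i + m + 1 by omega, coeff_succ_tOp, ih,
      h0]
    simp

/-- The second coefficient of `t ^ (n + 1) x = x t ^ (n + 1) + (n + 1) h t ^ n + ⋯`. -/
theorem coeff_tOp_pow_succ_C_X (h : k[X]) (n : ℕ) :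
    ((tOp h ^ (n + 1)) (C X)).coeff n = ((n + 1 : ℕ) : k[X]) * h := by
  induction n with
  | zero => simp [coeff_zero_tOp]
  | succ n ih =>
    have h1 : ((tOp h ^ (n + 1)) (C X)).coeff (n + 1) = X := by
      simpa using coeff_tOp_pow h (f := C X) (m := 0) (by simp) (n + 1)
    rw [pow_succ', Module.End.mul_apply, coeff_succ_tOp, ih, h1]
    push_cast
    simp
    ring

theorem aeval_mulLeft_C_X (p : k[X]) :
    aeval (LinearMap.mulLeft k (C X : k[X][X])) p = LinearMap.mulLeft k (C p) := by
  have e : (Algebra.lmul k k[X][X]) (C X) = LinearMap.mulLeft k (C X : k[X][X]) := rfl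
  rw [← e, aeval_algHom_apply]
  have e2 : aeval (C X : k[X][X]) p = C p := by
    have := aeval_algHom_apply (CAlgHom : k[X] →ₐ[k] k[X][X]) X p
    simpa using this
  rw [e2]
  rfl

/-- The representation of `A_h` on `k[X][Y]` in which `x` acts as multiplication by `X` and `t` as
`Y + h d/dX`. It is the left regular representation, written in the basis `x ^ i t ^ j`. -/
noncomputable def act (h : k[X]) : A h →ₐ[k] Module.End k k[X][X] :=
  lift h (LinearMap.mulLeft k (C X)) (tOp h) (by
    rw [aeval_mulLeft_C_X]
    ext1 f
    ext1 n
    cases n with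
    | zero =>
      simp [coeff_zero_tOp]
      ring
    | succ n =>
      simp [coeff_succ_tOp]
      ring)

theorem act_poly (h p : k[X]) (f : k[X][X]) : act h (poly h p) f = C p * f := by
  rw [act, lift_poly, aeval_mulLeft_C_X]
  rfl

theorem act_t (h : k[X]) : act h (t h) = tOp h := lift_t ..

theorem poly_X (h : k[X]) : poly h X = x h := by simp [poly]

/-! ### Normal forms -/

/-- Elements of `A_h` in normal form: `∑ pᵢ Yⁱ ↦ ∑ pᵢ(x) tⁱ`. -/
noncomputable def ofSymbol (h : k[X]) (f : k[X][X]) : A h := f.eval₂ (poly h : k[X] →+* A h) (t h)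

theorem ofSymbol_monomial (h p : k[X]) (i : ℕ) :
    ofSymbol h (monomial i p) = poly h p * t h ^ i := eval₂_monomial ..

theorem ofSymbol_C (h p : k[X]) : ofSymbol h (C p) = poly h p := eval₂_C ..

theorem ofSymbol_add (h : k[X]) (f g : k[X][X]) :
    ofSymbol h (f + g) = ofSymbol h f + ofSymbol h g := eval₂_add ..

theorem t_mul_poly (h p : k[X]) : t h * poly h p = poly h p * t h + poly h (h * derivative p) := by
  induction p using Polynomial.induction_on' with
  | add p q hp hq => simp only [map_add, mul_add, hp, hq, add_mul]; abel
  | monomial n c =>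
    rw [← C_mul_X_pow_eq_monomial]
    induction n with
    | zero => simp [poly, Algebra.commutes]
    | succ n ih =>
      rw [pow_succ, ← mul_assoc]
      generalize C c * X ^ n = p at ih ⊢
      have e : h * derivative (p * X) = p * h + h * derivative p * X := by
        rw [derivative_mul, derivative_X]
        ring
      rw [e, map_mul, ← mul_assoc, ih, add_mul, mul_assoc, poly_X, t_mul_x, mul_add, map_add,
        map_mul _ p h, map_mul _ _ X, poly_X, mul_assoc (poly h p), add_assoc]

/-- `A_h` is generated by `x` and `t`. -/
theorem mem_of_generators_mem {h : k[X]} (S : Subalgebra k (A h)) (hx : x h ∈ S) (ht : t h ∈ S)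
    (u : A h) : u ∈ S := by
  have hp : ((aeval (⟨x h, hx⟩ : S) h : S) : A h) = poly h h :=
    (aeval_algHom_apply S.val (⟨x h, hx⟩ : S) h).symm
  let φ : A h →ₐ[k] S := lift h (B := S) ⟨x h, hx⟩ ⟨t h, ht⟩ (by
    ext1
    rw [Subalgebra.coe_add, hp]
    exact t_mul_x h)
  have e : S.val.comp φ = AlgHom.id k (A h) := hom_ext (by simp [φ]) (by simp [φ])
  have := DFunLike.congr_fun e u
  rw [AlgHom.comp_apply, AlgHom.id_apply] at this
  exact this ▸ (φ u).2

/-- Under the normal form map, the action on `k[X][Y]` becomes left multiplication in `A_h`. -/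
theorem ofSymbol_act (h : k[X]) (u : A h) (f : k[X][X]) :
    ofSymbol h (act h u f) = u * ofSymbol h f := by
  let S : Subalgebra k (A h) :=
    { carrier := {u | ∀ f, ofSymbol h (act h u f) = u * ofSymbol h f}
      mul_mem' := fun {u v} hu hv f => by
        rw [map_mul, Module.End.mul_apply, hu, hv, mul_assoc]
      add_mem' := fun {u v} hu hv f => by
        rw [map_add, LinearMap.add_apply, ofSymbol_add, hu, hv, add_mul]
      algebraMap_mem' := fun c f => by
        have : algebraMap k (A h) c = poly h (C c) := by simp [poly]
        rw [this, act_poly]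
        induction f using Polynomial.induction_on' with
        | add f g hf hg => rw [mul_add, ofSymbol_add, ofSymbol_add, hf, hg, mul_add]
        | monomial i p => rw [C_mul_monomial, ofSymbol_monomial, ofSymbol_monomial, map_mul, mul_assoc] }
  refine mem_of_generators_mem S ?_ ?_ u f
  · intro f
    rw [← poly_X, act_poly]
    induction f using Polynomial.induction_on' with
    | add f g hf hg => rw [mul_add, ofSymbol_add, ofSymbol_add, hf, hg, mul_add]
    | monomial i p => rw [C_mul_monomial, ofSymbol_monomial, ofSymbol_monomial, map_mul, mul_assoc]
  · intro f
    rw [act_t]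
    induction f using Polynomial.induction_on' with
    | add f g hf hg => rw [map_add, ofSymbol_add, ofSymbol_add, hf, hg, mul_add]
    | monomial i p =>
      rw [tOp_monomial, ofSymbol_add, ofSymbol_monomial, ofSymbol_monomial, ofSymbol_monomial,
        ← mul_assoc, t_mul_poly, add_mul, mul_assoc, pow_succ']

/-- The coefficients of the normal form of an element of `A_h`. -/
noncomputable def symbol (h : k[X]) : A h →ₗ[k] k[X][X] := LinearMap.applyₗ 1 ∘ₗ (act h).toLinearMap

theorem symbol_apply (h : k[X]) (u : A h) : symbol h u = act h u 1 := rfl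

theorem ofSymbol_symbol (h : k[X]) (u : A h) : ofSymbol h (symbol h u) = u := by
  rw [symbol_apply, ofSymbol_act, ← C_1, ofSymbol_C, map_one, mul_one]

theorem symbol_injective (h : k[X]) : Function.Injective (symbol h) :=
  Function.LeftInverse.injective (ofSymbol_symbol h)

theorem symbol_poly (h p : k[X]) : symbol h (poly h p) = C p := by
  rw [symbol_apply, act_poly, mul_one]

theorem poly_injective (h : k[X]) : Function.Injective (poly h) := fun p q hpq =>
  C_injective (by rw [← symbol_poly h, ← symbol_poly h, hpq])

theorem symbol_mul (h : k[X]) (u v : A h) : symbol h (u * v) = act h u (symbol h v) := by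
  rw [symbol_apply, symbol_apply, map_mul, Module.End.mul_apply]

theorem eq_poly_of_natDegree_symbol {h : k[X]} {u : A h} (hu : (symbol h u).natDegree = 0) :
    u = poly h ((symbol h u).coeff 0) := by
  conv_lhs => rw [← ofSymbol_symbol h u, eq_C_of_natDegree_eq_zero hu, ofSymbol_C]

theorem act_eq_sum (h : k[X]) (u : A h) (f : k[X][X]) :
    act h u f = ∑ i ∈ Finset.range ((symbol h u).natDegree + 1),
      C ((symbol h u).coeff i) * (tOp h ^ i) f := by
  conv_lhs => rw [← ofSymbol_symbol h u, ofSymbol, eval₂_eq_sum_range]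
  simp only [map_sum, LinearMap.sum_apply, map_mul, Module.End.mul_apply, map_pow, act_t]
  exact Finset.sum_congr rfl fun i _ => act_poly ..

/-! ### Degree in `t` -/

theorem natDegree_act_le (h : k[X]) (u : A h) (f : k[X][X]) :
    (act h u f).natDegree ≤ (symbol h u).natDegree + f.natDegree := by
  rw [act_eq_sum]
  refine natDegree_sum_le_of_forall_le _ _ fun i hi => ?_
  refine (natDegree_C_mul_le _ _).trans ((natDegree_tOp_pow_le h le_rfl i).trans ?_)
  have := Finset.mem_range.1 hi
  omega

/-- The action of `u` multiplies leading coefficients, as multiplication by the symbol of `u`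
would. -/
theorem coeff_act (h : k[X]) (u : A h) (f : k[X][X]) :
    (act h u f).coeff ((symbol h u).natDegree + f.natDegree) =
      (symbol h u).leadingCoeff * f.leadingCoeff := by
  rw [act_eq_sum, finsetSum_coeff, Finset.sum_range_succ, Finset.sum_eq_zero, zero_add,
    coeff_C_mul, coeff_tOp_pow h le_rfl]
  · rfl
  · intro i hi
    have := Finset.mem_range.1 hi
    rw [coeff_C_mul, coeff_eq_zero_of_natDegree_lt (p := (tOp h ^ i) f), mul_zero]
    exact (natDegree_tOp_pow_le h le_rfl i).trans_lt (by omega)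

theorem natDegree_symbol_mul {h : k[X]} {u v : A h} (hu : u ≠ 0) (hv : v ≠ 0) :
    (symbol h (u * v)).natDegree = (symbol h u).natDegree + (symbol h v).natDegree := by
  refine le_antisymm (symbol_mul h u v ▸ natDegree_act_le ..) (le_natDegree_of_ne_zero ?_)
  rw [symbol_mul, coeff_act]
  have inj := symbol_injective h
  exact mul_ne_zero (leadingCoeff_ne_zero.2 ((map_ne_zero_iff _ inj).2 hu))
    (leadingCoeff_ne_zero.2 ((map_ne_zero_iff _ inj).2 hv))

/-- In characteristic zero, `k[x]` is its own centralizer in `A_h`. -/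
theorem eq_poly_of_commute_x [CharZero k] {h : k[X]} (hh : h ≠ 0) {u : A h}
    (hu : u * x h = x h * u) : ∃ p, u = poly h p := by
  refine ⟨_, eq_poly_of_natDegree_symbol ?_⟩
  by_contra hd
  obtain ⟨n, hn⟩ := Nat.exists_eq_succ_of_ne_zero hd
  have hu' := congrArg (fun v => (symbol h v).coeff n) hu
  simp only [symbol_mul, ← poly_X, symbol_poly, act_poly] at hu'
  rw [act_eq_sum, hn, Nat.succ_eq_add_one, Finset.sum_range_succ, Finset.sum_range_succ, coeff_add,
    coeff_add, finsetSum_coeff, Finset.sum_eq_zero, zero_add, coeff_C_mul, coeff_C_mul,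
    coeff_C_mul, coeff_tOp_pow_succ_C_X] at hu'
  · have h1 : ((tOp h ^ n) (C X)).coeff n = X := by
      simpa using coeff_tOp_pow h (f := C X) (m := 0) (by simp) n
    rw [h1, mul_comm X, add_eq_left] at hu'
    have hl : (symbol h u).coeff (n + 1) ≠ 0 := by
      rw [← Nat.succ_eq_add_one, ← hn]
      refine leadingCoeff_ne_zero.2 fun h0 => hd (by simp [h0])
    exact mul_ne_zero hl (mul_ne_zero (Nat.cast_ne_zero.2 n.succ_ne_zero) hh) hu'
  · intro i hi
    have := Finset.mem_range.1 hi
    rw [coeff_C_mul, coeff_eq_zero_of_natDegree_lt (p := (tOp h ^ i) (C X)), mul_zero]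
    exact (natDegree_tOp_pow_le h (f := C X) (m := 0) (by simp) i).trans_lt (by omega)

/-! ### The normal element `h` -/

theorem aeval_C_root (h p : k[X]) :
    aeval (C (AdjoinRoot.root h)) p = C (AdjoinRoot.mk h p) := by
  have e : C (AdjoinRoot.root h) = (CAlgHom : AdjoinRoot h →ₐ[k] _) (AdjoinRoot.root h) := rfl
  rw [e, aeval_algHom_apply, AdjoinRoot.aeval_eq]
  rfl

/-- The homomorphism from `A_h` to its largest commutative quotient `(k[x]/h)[t]`. -/
noncomputable def toQuot (h : k[X]) : A h →ₐ[k] (AdjoinRoot h)[X] :=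
  lift h (C (AdjoinRoot.root h)) X (by
    rw [aeval_C_root, AdjoinRoot.mk_self, map_zero, add_zero, mul_comm])

theorem toQuot_poly (h p : k[X]) : toQuot h (poly h p) = C (AdjoinRoot.mk h p) :=
  (lift_poly ..).trans (aeval_C_root h p)

theorem toQuot_ofSymbol (h : k[X]) (f : k[X][X]) :
    toQuot h (ofSymbol h f) = f.map (AdjoinRoot.mk h) := by
  induction f using Polynomial.induction_on' with
  | add f g hf hg => rw [ofSymbol_add, map_add, hf, hg, Polynomial.map_add]
  | monomial i p =>
    rw [ofSymbol_monomial, map_mul, toQuot_poly, map_pow, toQuot, lift_t, map_monomial,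
      C_mul_X_pow_eq_monomial]

theorem exists_eq_mul_of_toQuot_eq_zero {h : k[X]} {u : A h} (hu : toQuot h u = 0) :
    ∃ v, u = poly h h * v := by
  rw [← ofSymbol_symbol h u, toQuot_ofSymbol] at hu
  obtain ⟨g, hg⟩ : C h ∣ symbol h u := (C_dvd_iff_dvd_coeff _ _).2 fun i => by
    have := congrArg (fun f => f.coeff i) hu
    rwa [coeff_map, coeff_zero, AdjoinRoot.mk_eq_zero] at this
  refine ⟨ofSymbol h g, ?_⟩
  rw [← ofSymbol_symbol h u, hg, ← act_poly, ofSymbol_act]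

theorem poly_eq_commutator (h : k[X]) : poly h h = t h * x h - x h * t h := by
  rw [t_mul_x, add_sub_cancel_left]

/-- Every endomorphism sends `h = [t, x]` into the commutator ideal, which is `h A_h`. -/
theorem exists_map_poly_eq_mul {h : k[X]} (ρ : A h →ₐ[k] A h) :
    ∃ v, ρ (poly h h) = poly h h * v :=
  exists_eq_mul_of_toQuot_eq_zero (by
    rw [poly_eq_commutator]
    simp only [map_sub, map_mul]
    rw [mul_comm, sub_self])

instance (h : k[X]) : Nontrivial (A h) := (poly_injective h).nontrivial

instance (h : k[X]) : IsDomain (A h) :=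
  have : NoZeroDivisors (A h) := ⟨fun {u v} huv => by
    by_contra! hne
    have inj := symbol_injective h
    refine mul_ne_zero (leadingCoeff_ne_zero.2 ((map_ne_zero_iff _ inj).2 hne.1))
      (leadingCoeff_ne_zero.2 ((map_ne_zero_iff _ inj).2 hne.2)) ?_
    rw [← coeff_act, ← symbol_mul, huv]
    simp⟩
  NoZeroDivisors.to_isDomain _

theorem exists_eq_algebraMap_of_mul_eq_one {h : k[X]} {u v : A h} (huv : u * v = 1) :
    ∃ c : k, u = algebraMap k (A h) c := by
  have hu : u ≠ 0 := left_ne_zero_of_mul_eq_one huv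
  have hv : v ≠ 0 := right_ne_zero_of_mul_eq_one huv
  have hd := natDegree_symbol_mul hu hv
  rw [huv, ← map_one (poly h), symbol_poly, natDegree_C] at hd
  have hu' := eq_poly_of_natDegree_symbol (u := u) (by omega)
  have hv' := eq_poly_of_natDegree_symbol (u := v) (by omega)
  generalize (symbol h u).coeff 0 = p at hu'
  generalize (symbol h v).coeff 0 = q at hv'
  have hpq : p * q = 1 := poly_injective h (by rw [map_mul, ← hu', ← hv', huv, map_one])
  obtain ⟨c, -, hc⟩ := Polynomial.isUnit_iff.1 (IsUnit.of_mul_eq_one _ hpq)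
  exact ⟨c, by rw [hu', ← hc]; simp [poly]⟩

/-- Every automorphism maps `h` to a scalar multiple of `h`. -/
theorem exists_map_poly_eq_smul {h : k[X]} (hh : h ≠ 0) (ρ : A h ≃ₐ[k] A h) :
    ∃ c : k, ρ (poly h h) = poly h (C c * h) := by
  obtain ⟨u, hu⟩ := exists_map_poly_eq_mul (ρ : A h →ₐ[k] A h)
  obtain ⟨v, hv⟩ := exists_map_poly_eq_mul (ρ.symm : A h →ₐ[k] A h)
  rw [AlgEquiv.coe_toAlgHom] at hu hv
  have h0 : poly h h ≠ 0 := (map_ne_zero_iff _ (poly_injective h)).2 hh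
  -- From `ρ(h) = h u` and `ρ⁻¹(h) = h v` follows `h = ρ(h) ρ(v) = h u ρ(v)`.
  have huv : u * ρ v = 1 := by
    have := congrArg ρ hv
    rw [AlgEquiv.apply_symm_apply, map_mul, hu, mul_assoc] at this
    exact (mul_left_cancel₀ h0 (by rw [← this, mul_one]))
  obtain ⟨c, rfl⟩ := exists_eq_algebraMap_of_mul_eq_one huv
  refine ⟨c, ?_⟩
  rw [hu, ← Algebra.commutes, map_mul]
  simp [poly]

/-! ### Automorphisms -/

/-- A root `α` of `h` splits off the factor `ρ(x) - α` of `ρ(h) ∈ k^* h`, which forces `ρ(x)` to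
have degree zero in `t`. -/
theorem exists_map_x_eq_poly [IsAlgClosed k] {h : k[X]} (hdeg : 1 ≤ h.natDegree)
    (ρ : A h ≃ₐ[k] A h) : ∃ q, ρ (x h) = poly h q := by
  have hh : h ≠ 0 := by rintro rfl; simp at hdeg
  obtain ⟨c, hc⟩ := exists_map_poly_eq_smul hh ρ
  obtain ⟨α, hα⟩ := IsAlgClosed.exists_root h (by
    rw [degree_eq_natDegree hh]
    exact_mod_cast (by omega : h.natDegree ≠ 0))
  obtain ⟨g, hg⟩ := dvd_iff_isRoot.2 hα
  have hne : ∀ p ≠ 0, ρ (poly h p) ≠ 0 := fun p hp =>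
    (map_ne_zero_iff _ ρ.injective).2 ((map_ne_zero_iff _ (poly_injective h)).2 hp)
  have hd := natDegree_symbol_mul (hne _ (X_sub_C_ne_zero α))
    (hne g (by rintro rfl; exact hh (by simpa using hg)))
  rw [← map_mul, ← map_mul, ← hg, hc, symbol_poly, natDegree_C] at hd
  have hq := eq_poly_of_natDegree_symbol (u := ρ (poly h (X - C α))) (by omega)
  generalize (symbol h _).coeff 0 = q at hq
  refine ⟨q + C α, ?_⟩
  rw [map_add, ← hq, map_sub, map_sub, poly_X]
  have : ρ (poly h (C α)) = poly h (C α) := by simp [poly]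
  rw [this, sub_add_cancel]

theorem aeval_poly (h p q : k[X]) : aeval (poly h q) p = poly h (p.comp q) := by
  rw [comp_eq_aeval, ← aeval_algHom_apply]

theorem map_poly {h q : k[X]} {ρ : A h ≃ₐ[k] A h} (hq : ρ (x h) = poly h q) (p : k[X]) :
    ρ (poly h p) = poly h (p.comp q) := by
  rw [← aeval_poly, ← hq]
  exact (aeval_algHom_apply (ρ : A h →ₐ[k] A h) (x h) p).symm

/-- The absence of the term of degree `N - 1` in `h` excludes translations of `x`. -/
theorem exists_scaling [CharZero k] {h q : k[X]} {c : k} (hdeg : 1 ≤ h.natDegree) (hmonic : h.Monic)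
    (hcoeff : h.coeff (h.natDegree - 1) = 0) (hq : h.comp q = C c * h) (hc : c ≠ 0) :
    ∃ a : kˣ, q = C (a : k) * X ∧ IsScaling h a := by
  have hd := congrArg natDegree hq
  rw [natDegree_comp, natDegree_C_mul hc] at hd
  have hd1 : q.natDegree = 1 := Nat.eq_of_mul_eq_mul_left hdeg (by rw [hd, mul_one])
  obtain ⟨a, ha, b, rfl⟩ := natDegree_eq_one.1 hd1
  obtain ⟨N, hN⟩ := Nat.exists_eq_add_of_le' hdeg
  have hca : c = a ^ h.natDegree := by
    have := congrArg leadingCoeff hq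
    rw [leadingCoeff_comp (by omega), leadingCoeff_mul, hmonic.leadingCoeff, leadingCoeff_linear ha,
      leadingCoeff_C] at this
    simpa using this.symm
  have hb : b = 0 := by
    -- The coefficient of `x ^ N` in `h(ax + b)` is `a ^ N` times that in `h(x + b)`, which is the
    -- value at `b` of the Hasse derivative of `h` of order `N = deg h - 1`, that is, `(N + 1) b`.
    have hN' : h.natDegree - 1 = N := by omega
    rw [hN'] at hcoeff
    have e : h.comp (C a * X + C b) = (taylor b h).comp (C a * X) := by
      simp [taylor_apply, comp_assoc]
    have hH : hasseDeriv N h = C ((N + 1 : ℕ) : k) * X := by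
      ext n
      rw [hasseDeriv_coeff, coeff_C_mul, coeff_X]
      obtain rfl | rfl | hn : n = 0 ∨ n = 1 ∨ 2 ≤ n := by omega
      · simp [hcoeff]
      · have h1 : h.coeff (1 + N) = 1 := by rw [add_comm, ← hN]; exact hmonic
        rw [h1, add_comm 1 N, Nat.choose_succ_self_right]
        simp
      · rw [coeff_eq_zero_of_natDegree_lt (by omega), if_neg (by omega)]
        simp
    have h1 := congrArg (fun p => p.coeff N) hq
    simp only [e, comp_C_mul_X_coeff, coeff_C_mul, hcoeff, taylor_coeff, hH, eval_mul, eval_C,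
      eval_X, mul_zero] at h1
    simpa [ha, Nat.cast_add_one_ne_zero] using h1
  subst hb hca
  refine ⟨Units.mk0 a ha, by simp, ?_⟩
  simpa [IsScaling] using hq

theorem σ_mul_τ_x (h r : k[X]) (a : kˣ) (ha : IsScaling h a) :
    (σ h r * τ h a ha) (x h) = poly h (C (a : k) * X) := by
  rw [AlgEquiv.mul_apply, τ_x, map_smul, σ_x, map_mul, poly_X, Algebra.smul_def]
  simp [poly]

theorem σ_mul_τ_t (h r : k[X]) (a : kˣ) (ha : IsScaling h a) :
    (σ h r * τ h a ha) (t h) = (a : k) ^ ((h.natDegree : ℤ) - 1) • (t h + poly h r) := by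
  rw [AlgEquiv.mul_apply, τ_t, map_smul, σ_t]

theorem exists_eq_σ_mul_τ [IsAlgClosed k] [CharZero k] {h : k[X]} (hdeg : 1 ≤ h.natDegree)
    (hmonic : h.Monic) (hcoeff : h.coeff (h.natDegree - 1) = 0) (ρ : A h ≃ₐ[k] A h) :
    ∃ (r : k[X]) (a : kˣ) (ha : IsScaling h a), ρ = σ h r * τ h a ha := by
  obtain ⟨c, hc⟩ := exists_map_poly_eq_smul hmonic.ne_zero ρ
  obtain ⟨q, hq⟩ := exists_map_x_eq_poly hdeg ρ
  have hcomp : h.comp q = C c * h := poly_injective h (by rw [← map_poly hq, hc])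
  have hc0 : c ≠ 0 := by
    rintro rfl
    rw [C_0, zero_mul, map_zero] at hc
    have := (map_eq_zero_iff _ ρ.injective).1 hc
    exact hmonic.ne_zero ((map_eq_zero_iff _ (poly_injective h)).1 this)
  obtain ⟨a, rfl, ha⟩ := exists_scaling hdeg hmonic hcoeff hcomp hc0
  -- `ρ` and `τ_a` agree at `x`, so `ρ(t)` and `τ_a(t)` differ by an element commuting with `x`.
  set b : k := (a : k) ^ ((h.natDegree : ℤ) - 1) with hb
  have hb0 : b ≠ 0 := zpow_ne_zero _ a.ne_zero
  have hx : ρ (x h) = (a : k) • x h := by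
    rw [hq, map_mul, poly_X, Algebra.smul_def]
    simp [poly]
  have hρ : ρ (t h) * x h - x h * ρ (t h) = b • (t h * x h - x h * t h) := by
    have hab : (a : k) * b = (a : k) ^ h.natDegree := by
      rw [hb, zpow_sub_one₀ a.ne_zero, mul_comm, inv_mul_cancel_right₀ a.ne_zero, zpow_natCast]
    have h1 := congrArg ρ (poly_eq_commutator h)
    rw [map_poly hq, show h.comp (C (a : k) * X) = _ from ha, ← hab, ← smul_eq_C_mul, map_smul,
      map_sub, map_mul, map_mul, hx, mul_smul_comm, smul_mul_assoc,
      ← smul_sub (a : k) (ρ (t h) * x h) (x h * ρ (t h)), mul_smul, poly_eq_commutator] at h1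
    exact (smul_right_injective _ a.ne_zero h1).symm
  obtain ⟨p, hp⟩ := eq_poly_of_commute_x hmonic.ne_zero (u := ρ (t h) - b • t h) (by
    rw [sub_mul, mul_sub, sub_eq_sub_iff_sub_eq_sub, hρ, smul_sub, smul_mul_assoc, mul_smul_comm])
  refine ⟨C b⁻¹ * p, a, ha, AlgEquiv.coe_toAlgHom_injective (hom_ext ?_ ?_)⟩
  · exact hq.trans (σ_mul_τ_x ..).symm
  · refine Eq.trans ?_ (σ_mul_τ_t ..).symm
    change ρ (t h) = _
    rw [← hb, smul_add, ← map_smul, smul_eq_C_mul, ← mul_assoc, ← C_mul, mul_inv_cancel₀ hb0, C_1,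
      one_mul, ← hp, add_sub_cancel]

/-! ### Conjugation of derivations -/

theorem conjRep_apply_apply {R : Type*} [Ring R] [Algebra k R] (ρ : R ≃ₐ[k] R) (D : Der k R)
    (u : R) : (conjRep k R ρ D : Module.End k R) u = ρ ((D : Module.End k R) (ρ.symm u)) := rfl

theorem conjRep_eq_iff {R : Type*} [Ring R] [Algebra k R] {ρ : R ≃ₐ[k] R} {D E : Der k R} :
    conjRep k R ρ D = E ↔
      ∀ u, ρ ((D : Module.End k R) u) = (E : Module.End k R) (ρ u) := by
  constructor
  · rintro rfl u
    rw [conjRep_apply_apply, AlgEquiv.symm_apply_apply]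
  · intro hu
    ext u
    rw [conjRep_apply_apply, hu, AlgEquiv.apply_symm_apply]

theorem mem_isotropy_iff {R : Type*} [Ring R] [Algebra k R] {ρ : R ≃ₐ[k] R} {D : Der k R} :
    ρ ∈ isotropy D ↔ conjRep k R ρ D = D := conjRep_eq_iff.symm

theorem conjRep_ad {R : Type*} [Ring R] [Algebra k R] (ρ : R ≃ₐ[k] R) (w : R) :
    conjRep k R ρ (ad k w) = ad k (ρ w) := by
  rw [conjRep_eq_iff]
  intro u
  simp [ad_apply]

theorem Δ_poly (h s p : k[X]) : (Δ h s : Module.End k (A h)) (poly h p) = 0 := by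
  have hder : ∀ u v, (Δ h s : Module.End k (A h)) (u * v) = _ := (Δ h s).2
  have h1 : (Δ h s : Module.End k (A h)) 1 = 0 := by simpa using hder 1 1
  induction p using Polynomial.induction_on' with
  | add p q hp hq => rw [map_add, map_add, hp, hq, add_zero]
  | monomial n c =>
    induction n with
    | zero =>
      rw [monomial_zero_left, show poly h (C c) = c • 1 by simp [poly, Algebra.algebraMap_eq_smul_one],
        map_smul, h1, smul_zero]
    | succ n ih => rw [← monomial_mul_X, map_mul, hder, ih, poly_X, Δ_x, zero_mul, mul_zero, add_zero]

/-- The relation `ρ D ρ⁻¹ = E` may be checked as `ρ D = E ρ` on the generators. -/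
theorem conjRep_eq_of_generators {h : k[X]} {ρ : A h ≃ₐ[k] A h} {D E : Der k (A h)}
    (hx : ρ ((D : Module.End k (A h)) (x h)) = (E : Module.End k (A h)) (ρ (x h)))
    (ht : ρ ((D : Module.End k (A h)) (t h)) = (E : Module.End k (A h)) (ρ (t h))) :
    conjRep k (A h) ρ D = E := by
  have e : D = conjRep k (A h) ρ⁻¹ E :=
    der_ext (ρ.symm_apply_eq.2 hx.symm).symm (ρ.symm_apply_eq.2 ht.symm).symm
  rw [e, ← Module.End.mul_apply, ← map_mul, mul_inv_cancel, map_one, Module.End.one_apply]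

theorem conjRep_σ_mul_τ_Δ (h r s : k[X]) (a : kˣ) (ha : IsScaling h a) :
    conjRep k (A h) (σ h r * τ h a ha) (Δ h s) =
      Δ h (C ((a : k) ^ (1 - (h.natDegree : ℤ))) * s.comp (C (a : k) * X)) := by
  apply conjRep_eq_of_generators
  · rw [Δ_x, map_zero, σ_mul_τ_x, Δ_poly]
  · rw [Δ_t, map_poly (σ_mul_τ_x h r a ha), σ_mul_τ_t, map_smul, map_add, Δ_t, Δ_poly, add_zero,
      ← map_smul, smul_eq_C_mul, ← mul_assoc, ← C_mul, ← zpow_add₀ a.ne_zero]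
    simp

theorem degree_scale_lt {h s : k[X]} (hs : s.degree < h.degree) (c : k) (a : kˣ) :
    (C c * s.comp (C (a : k) * X)).degree < h.degree := by
  rw [← smul_eq_C_mul]
  refine (degree_smul_le _ _).trans_lt (lt_of_le_of_lt ?_ hs)
  refine degree_le_iff_coeff_zero _ _ |>.2 fun n hn => ?_
  rw [comp_C_mul_X_coeff, coeff_eq_zero_of_degree_lt hn, zero_mul]

/-- If `ad_w = Δ_s` then `w` commutes with `x`, so `w = p(x)` and `s = [p, t] = -h p'`, which has
degree at least `deg h` unless it vanishes. -/
theorem eq_zero_of_ad_eq_Δ [CharZero k] {h : k[X]} (hh : h ≠ 0) {w : A h} {s : k[X]}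
    (hs : s.degree < h.degree) (hw : ad k w = Δ h s) : s = 0 := by
  have hx : w * x h - x h * w = 0 := by rw [← ad_apply k, hw, Δ_x]
  obtain ⟨p, rfl⟩ := eq_poly_of_commute_x hh (sub_eq_zero.1 hx)
  have ht : poly h p * t h - t h * poly h p = poly h s := by rw [← ad_apply k, hw, Δ_t]
  rw [t_mul_poly, sub_add_cancel_left, ← map_neg] at ht
  have hs' := poly_injective h ht
  have hdvd : h ∣ s := hs' ▸ (dvd_mul_right h _).neg_right
  exact eq_zero_of_dvd_of_degree_lt hdvd hs

theorem Δ_zero (h : k[X]) : Δ h 0 = 0 := der_ext (by simp [Δ_x]) (by simp [Δ_t])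

theorem Δ_add (h s s' : k[X]) : Δ h (s + s') = Δ h s + Δ h s' :=
  der_ext (by simp [Δ_x]) (by simp [Δ_t])

theorem Δ_smul (h s : k[X]) (c : k) : Δ h (c • s) = c • Δ h s :=
  der_ext (by simp [Δ_x]) (by simp [Δ_t])

/-- `Inn(R)` as a subrepresentation of `Der(R)`. -/
def innSubrep (k R : Type*) [Field k] [Ring R] [Algebra k R] :
    Subrepresentation (conjRep k R) where
  toSubmodule :=
    { carrier := Inn k R
      zero_mem' := ⟨0, by ext u; simp [ad_apply]⟩
      add_mem' := by
        rintro _ _ ⟨v, rfl⟩ ⟨w, rfl⟩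
        refine ⟨v + w, ?_⟩
        ext u
        simp [ad_apply, add_mul, mul_add]
        abel
      smul_mem' := by
        rintro c _ ⟨w, rfl⟩
        refine ⟨c • w, ?_⟩
        ext u
        simp [ad_apply, smul_sub] }
  apply_mem_toSubmodule ρ := by
    rintro _ ⟨w, rfl⟩
    exact ⟨ρ w, conjRep_ad ρ w⟩

/-- `Δ(A_h)` as a subspace of `Der(A_h)`. -/
def deltaSubmodule {h : k[X]} (hh : h ≠ 0) : Submodule k (Der k (A h)) where
  carrier := DeltaSet h
  zero_mem' := ⟨0, by simpa [bot_lt_iff_ne_bot] using hh, (Δ_zero h).symm⟩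
  add_mem' := by
    rintro _ _ ⟨s, hs, rfl⟩ ⟨s', hs', rfl⟩
    exact ⟨s + s', (degree_add_le _ _).trans_lt (max_lt hs hs'), (Δ_add ..).symm⟩
  smul_mem' := by
    rintro c _ ⟨s, hs, rfl⟩
    exact ⟨c • s, (degree_smul_le _ _).trans_lt hs, (Δ_smul ..).symm⟩

theorem disjoint_innSubrep_deltaSubmodule [CharZero k] {h : k[X]} (hh : h ≠ 0) :
    Disjoint (innSubrep k (A h)).toSubmodule (deltaSubmodule hh) := by
  rw [Submodule.disjoint_def]
  rintro D ⟨w, hw⟩ ⟨s, hs, rfl⟩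
  rw [eq_zero_of_ad_eq_Δ hh hs hw.symm, Δ_zero]

theorem eq_and_eq_of_add_eq_add {V : Type*} [AddCommGroup V] [Module k V] {I S : Submodule k V}
    (hIS : Disjoint I S) {v v' w w' : V} (hv : v ∈ I) (hv' : v' ∈ I) (hw : w ∈ S) (hw' : w' ∈ S)
    (e : v + w = v' + w') : v = v' ∧ w = w' := by
  have h1 : v - v' = w' - w := sub_eq_sub_iff_add_eq_add.2 (e.trans (add_comm v' w'))
  have h0 : v - v' = 0 :=
    Submodule.disjoint_def.1 hIS _ (sub_mem hv hv') (h1 ▸ sub_mem hw' hw)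
  exact ⟨sub_eq_zero.1 h0, (sub_eq_zero.1 (h1.symm.trans h0)).symm⟩

/-- For stable subspaces with zero intersection, the components of an invariant vector are
invariant. -/
theorem isotropy_add {R : Type*} [Ring R] [Algebra k R] {D E : Der k R}
    (I S : Subrepresentation (conjRep k R)) (hIS : Disjoint I.toSubmodule S.toSubmodule)
    (hD : D ∈ I.toSubmodule) (hE : E ∈ S.toSubmodule) :
    isotropy (D + E) = isotropy D ⊓ isotropy E := by
  ext ρ
  rw [Subgroup.mem_inf, mem_isotropy_iff, mem_isotropy_iff, mem_isotropy_iff, map_add]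
  refine ⟨fun hρ => ?_, fun ⟨h1, h2⟩ => by rw [h1, h2]⟩
  exact eq_and_eq_of_add_eq_add hIS (I.apply_mem_toSubmodule ρ hD) hD
    (S.apply_mem_toSubmodule ρ hE) hE hρ

end DiffOre

open DiffOre in
theorem mainTheorem9 {k : Type*} [Field k] [IsAlgClosed k] [CharZero k]
    (h : Polynomial k) (hdeg : 1 ≤ h.natDegree) (hmonic : h.Monic)
    (hcoeff : h.coeff (h.natDegree - 1) = 0) :
    -- every automorphism is some `σ_r ∘ τ_a`
    (∀ ρ : A h ≃ₐ[k] A h, ∃ (r : Polynomial k) (a : kˣ) (ha : IsScaling h a),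
      ρ = σ h r * τ h a ha) ∧
    -- conjugation formula on `Δ(A_h)`
    (∀ (r : Polynomial k) (a : kˣ) (ha : IsScaling h a) (s : Polynomial k),
      s.degree < h.degree →
      conjRep k (A h) (σ h r * τ h a ha) (Δ h s) =
        Δ h (Polynomial.C ((a : k) ^ (1 - (h.natDegree : ℤ))) *
          s.comp (Polynomial.C (a : k) * Polynomial.X))) ∧
    -- `Inn(A_h)` and `Δ(A_h)` are independent `Aut(A_h)`-submodules of `Der(A_h)`
    (∃ I S : Subrepresentation (conjRep k (A h)),
      (I : Set (Der k (A h))) = Inn k (A h) ∧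
      (S : Set (Der k (A h))) = DeltaSet h ∧
      Disjoint I.toSubmodule S.toSubmodule) ∧
    -- isotropy group of a sum
    (∀ (w : A h) (s : Polynomial k), s.degree < h.degree →
      isotropy (ad k w + Δ h s) = isotropy (ad k w) ⊓ isotropy (Δ h s)) := by
  have hh := hmonic.ne_zero
  have hAut := exists_eq_σ_mul_τ hdeg hmonic hcoeff
  let S : Subrepresentation (conjRep k (A h)) := ⟨deltaSubmodule hh, by
    rintro ρ _ ⟨s, hs, rfl⟩
    obtain ⟨r, a, ha, rfl⟩ := hAut ρ
    exact ⟨_, degree_scale_lt hs _ a, conjRep_σ_mul_τ_Δ h r s a ha⟩⟩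
  have hIS := disjoint_innSubrep_deltaSubmodule hh
  exact ⟨hAut, fun r a ha s _ => conjRep_σ_mul_τ_Δ h r s a ha,
    ⟨innSubrep k (A h), S, rfl, rfl, hIS⟩,
    fun w s hs => isotropy_add (innSubrep k (A h)) S hIS ⟨w, rfl⟩ ⟨s, hs, rfl⟩⟩
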